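/- **Theorem 4.1.** Let $n\ge 0$ and let $a_0,\dots,a_n$ be positive integers. On $\mathbb{C}^{n+1}$ with coordinates $z_j=x_j+iy_j$ put $$\alpha=\tfrac14\sum_{j=0}^n a_j(x_j\,dy_j-y_j\,dx_j),\qquad Z=4i\sum_{j=0}^n\frac1{a_j}\Big(z_j\frac{\partial}{\partial z_j}-\bar z_j\frac{\partial}{\partial\bar z_j}\Big),$$ and let $$S^{2n+1}=\Big\{z:\sum_j|z_j|^2=1\Big\},\qquad B=\Big\{z:\sum_j|z_j|^2=1,\ \sum_j z_j^{a_j}=0\Big\}$$ ($B$ is the Brieskorn manifold; it is empty for $n=0$ and need not be connected). Let $$V_1=2i\sum_{j}\Big(\bar z_j^{\,a_j-1}\frac{\partial}{\partial z_j}-z_j^{a_j-1}\frac{\partial}{\partial\bar z_j}\Big),\quad V_2=-2\sum_{j}\Big(\bar z_j^{\,a_j-1}\frac{\partial}{\partial z_j}+z_j^{a_j-1}\frac{\partial}{\partial\bar z_j}\Big),\quad \mu=2\sum_j a_j|z_j|^{2(a_j-1)}.$$ For a contact form $\alpha$ on a manifold $M$ with Reeb field $Z_M$ (that is, $i_{Z_M}\alpha=1$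 and $i_{Z_M}d\alpha=0$ on $M$), the contact Hamiltonian vector field of $f\in C^\infty(M)$ is $Y_f=fZ_M+\hat Y_f$, where $\hat Y_f$ is tangent to $M$ with $\alpha(\hat Y_f)=0$ and $-i_{\hat Y_f}d\alpha=df-Z_M(f)\,\alpha$, and the Jacobi bracket is $[f,g]=d\alpha(Y_f,Y_g)+f\,Z_M(g)-g\,Z_M(f)$. Here "contact" means that $M$ is an embedded submanifold transverse to $\ker\alpha$ and that $d\alpha$ is nondegenerate on $\ker\alpha\cap TM$. Then $(S^{2n+1},\alpha)$ is a contact manifold of dimension $2n+1$, and $(B,\alpha)$ is a contact manifold, of dimension $2n-1$ when $n\ge1$; $Z$ restricts to the Reeb vector field of each of them; at every point of $B$ the vectors $V_1,V_2$ are tangent to $S^{2n+1}$ and $$\mu=2\sum_j a_j\big(|z_j|^2\big)^{a_j-1}\neq0.$$ Moreover, for all smooth functions $f,g$ on $S^{2n+1}$ with $Z(f)=Z(g)=0$ on $S^{2n+1}$, at every point of $B$, $$[f|_B,g|_B]_B=[f,g]+\frac{df(V_2)\,dg(V_1)-df(V_1)\,dg(V_2)}{\mu},$$ where $[\cdot,\cdot]_B$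 is the Jacobi bracket on $(B,\alpha)$ and $[\cdot,\cdot]$ is the Jacobi bracket on $(S^{2n+1},\alpha)$. -/

import Mathlib

open scoped Topology ContDiff

noncomputable section

namespace ContactGeometry

variable {E : Type*} [NormedAddCommGroup E] [NormedSpace ℝ E]

/-- `M` is a smooth embedded `d`-dimensional submanifold of `E`: near each of its points it is the
zero set of a smooth map to some `ℝ^k` which is a submersion at that point, where
`k + d = dim E`. -/
def IsSubmanifold (M : Set E) (d : ℕ) : Prop :=
  ∀ x ∈ M, ∃ (k : ℕ) (U : Set E) (Φ : E → (Fin k → ℝ)),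
    k + d = Module.finrank ℝ E ∧ IsOpen U ∧ x ∈ U ∧ ContDiffOn ℝ ∞ Φ U ∧
    Function.Surjective (fderiv ℝ Φ x) ∧ M ∩ U = {y ∈ U | Φ y = 0}

/-- The tangent space `T_x M` of a submanifold `M ⊆ E`, seen inside `E`: the velocities at time `0`
of the curves that run in `M`, pass through `x` at time `0` and are differentiable there. -/
def tangentSpaceAt (M : Set E) (x : E) : Set E :=
  {v | ∃ γ : ℝ → E, γ 0 = x ∧ (∀ᶠ t in 𝓝 (0 : ℝ), γ t ∈ M) ∧ HasDerivAt γ v 0}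

/-- A smooth function on `M`, represented by a function on `E` of which only the values on `M`
matter: near each point of `M` it is the restriction of a smooth function on an open set of `E`. -/
def IsSmoothOn (M : Set E) (f : E → ℝ) : Prop :=
  ∀ x ∈ M, ∃ (U : Set E) (F : E → ℝ), IsOpen U ∧ x ∈ U ∧ ContDiffOn ℝ ∞ F U ∧ Set.EqOn F f (U ∩ M)

/-- The differential `df_x(v)` of a function on `M` in the direction `v ∈ T_x M`. For tangent `v`
its value is that of `v` applied to any local smooth extension, see `hasDerivAt_comp_curve`. -/
def differential (M : Set E) (f : E → ℝ) (x v : E) : ℝ := fderivWithin ℝ f M x v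

/-- `differential` is the derivative along every curve in `M` with the given velocity; in particular
it depends only on the values of `f` on `M`. -/
theorem hasDerivAt_comp_curve {M : Set E} {f : E → ℝ} (hf : IsSmoothOn M f) {x v : E} (hx : x ∈ M)
    {γ : ℝ → E} (h0 : γ 0 = x) (hM : ∀ᶠ t in 𝓝 (0 : ℝ), γ t ∈ M) (hγ : HasDerivAt γ v 0) :
    HasDerivAt (fun t => f (γ t)) (differential M f x v) 0 := by
  obtain ⟨U, F, hU, hxU, hF, hEq⟩ := hf x hx
  have hFd : DifferentiableWithinAt ℝ F M x :=
    ((hF.contDiffAt (hU.mem_nhds hxU)).differentiableAt (by simp)).differentiableWithinAt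
  have hfd : DifferentiableWithinAt ℝ f M x := by
    refine hFd.congr_of_eventuallyEq ?_ (hEq ⟨hxU, hx⟩).symm
    filter_upwards [self_mem_nhdsWithin, mem_nhdsWithin_of_mem_nhds (hU.mem_nhds hxU)]
      with y hy hyU
    exact (hEq ⟨hyU, hy⟩).symm
  subst h0
  have h1 := hfd.hasFDerivWithinAt.comp_hasDerivWithinAt (s := γ ⁻¹' M) (0 : ℝ)
    hγ.hasDerivWithinAt (fun t ht => ht)
  exact h1.hasDerivAt hM

/-- The exterior derivative `dα_x(v, w)` of a one-form on `E`. Restricted to tangent vectors of a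
submanifold it is the exterior derivative of the pulled back form. -/
def dForm (α : E → E →L[ℝ] ℝ) (x v w : E) : ℝ := fderiv ℝ α x v w - fderiv ℝ α x w v

/-- `(M, α|_M)` is a co-oriented contact manifold of dimension `2 * m + 1`: `M` is a submanifold
transverse to `ker α`, and `dα` is nondegenerate on `ker α ∩ T_x M`. -/
structure IsContact (M : Set E) (α : E → E →L[ℝ] ℝ) (m : ℕ) : Prop where
  contDiff : ContDiff ℝ ∞ α
  submanifold : IsSubmanifold M (2 * m + 1)
  transverse : ∀ x ∈ M, ∃ v ∈ tangentSpaceAt M x, α x v ≠ 0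
  nondegenerate : ∀ x ∈ M, ∀ v ∈ tangentSpaceAt M x, α x v = 0 →
    (∀ w ∈ tangentSpaceAt M x, α x w = 0 → dForm α x v w = 0) → v = 0

/-- `Z` is the value at `x` of the Reeb vector field of `(M, α|_M)`:
`i_Z α = 1` and `i_Z dα = 0`. -/
def IsReebAt (M : Set E) (α : E → E →L[ℝ] ℝ) (x Z : E) : Prop :=
  Z ∈ tangentSpaceAt M x ∧ α x Z = 1 ∧ ∀ w ∈ tangentSpaceAt M x, dForm α x Z w = 0

/-- The Reeb vector field of the contact manifold `(M, α|_M)`. -/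
def reeb (M : Set E) (α : E → E →L[ℝ] ℝ) (x : E) : E :=
  Classical.epsilon fun Z => IsReebAt M α x Z

/-- The horizontal part `Ŷ_f` of the contact Hamiltonian vector field: the horizontal tangent vector
with `- i_Ŷ dα = df - (Z f) α`. -/
def horizontalHam (M : Set E) (α : E → E →L[ℝ] ℝ) (f : E → ℝ) (x : E) : E :=
  Classical.epsilon fun Y => Y ∈ tangentSpaceAt M x ∧ α x Y = 0 ∧
    ∀ w ∈ tangentSpaceAt M x, - dForm α x Y w =
      differential M f x w - differential M f x (reeb M α x) * α x w

/-- The contact Hamiltonian vector field `Y_f = f Z + Ŷ_f` on `(M, α|_M)`. -/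
def contactHam (M : Set E) (α : E → E →L[ℝ] ℝ) (f : E → ℝ) (x : E) : E :=
  f x • reeb M α x + horizontalHam M α f x

/-- The Jacobi bracket `[f, g] = dα(Y_f, Y_g) + f Z(g) - g Z(f)` on `(M, α|_M)`. -/
def jacobiBracket (M : Set E) (α : E → E →L[ℝ] ℝ) (f g : E → ℝ) (x : E) : ℝ :=
  dForm α x (contactHam M α f x) (contactHam M α g x)
    + f x * differential M g x (reeb M α x) - g x * differential M f x (reeb M α x)

end ContactGeometry

namespace Brieskorn

variable {n : ℕ}

/-- The unit sphere `S^{2n+1}` in `ℂ^{n+1}`. -/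
def unitSphere (n : ℕ) : Set (Fin (n + 1) → ℂ) := {z | ∑ j, ‖z j‖ ^ 2 = 1}

/-- The Brieskorn manifold `B`. -/
def manifold (a : Fin (n + 1) → ℕ) : Set (Fin (n + 1) → ℂ) :=
  {z | ∑ j, ‖z j‖ ^ 2 = 1 ∧ ∑ j, z j ^ a j = 0}

/-- The one-form `α = ¼ ∑ a_j (x_j dy_j - y_j dx_j)` on `ℂ^{n+1}`, where `z_j = x_j + i y_j`. -/
def form (a : Fin (n + 1) → ℕ) (z : Fin (n + 1) → ℂ) : (Fin (n + 1) → ℂ) →L[ℝ] ℝ :=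
  (1 / 4 : ℝ) • ∑ j, (a j : ℝ) •
    ((z j).re • (Complex.imCLM ∘L ContinuousLinearMap.proj (R := ℝ) (φ := fun _ => ℂ) j)
      - (z j).im • (Complex.reCLM ∘L ContinuousLinearMap.proj (R := ℝ) (φ := fun _ => ℂ) j))

/-- The vector field `4 i ∑ (1 / a_j) (z_j ∂/∂z_j - z̄_j ∂/∂z̄_j)`. A real vector field
`∑ (c_j ∂/∂z_j + c̄_j ∂/∂z̄_j)` is identified with `(c_j)_j`. -/
def reebField (a : Fin (n + 1) → ℕ) (z : Fin (n + 1) → ℂ) : Fin (n + 1) → ℂ :=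
  fun j => 4 * Complex.I / (a j : ℂ) * z j

/-- `V_1 = 2 i ∑ (z̄_j^{a_j - 1} ∂/∂z_j - z_j^{a_j - 1} ∂/∂z̄_j)`. -/
def V₁ (a : Fin (n + 1) → ℕ) (z : Fin (n + 1) → ℂ) : Fin (n + 1) → ℂ :=
  fun j => 2 * Complex.I * (starRingEnd ℂ (z j)) ^ (a j - 1)

/-- `V_2 = - 2 ∑ (z̄_j^{a_j - 1} ∂/∂z_j + z_j^{a_j - 1} ∂/∂z̄_j)`. -/
def V₂ (a : Fin (n + 1) → ℕ) (z : Fin (n + 1) → ℂ) : Fin (n + 1) → ℂ :=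
  fun j => -2 * (starRingEnd ℂ (z j)) ^ (a j - 1)

/-- `μ = 2 ∑ a_j |z_j|^{2 (a_j - 1)}`. -/
def mu (a : Fin (n + 1) → ℕ) (z : Fin (n + 1) → ℂ) : ℝ :=
  2 * ∑ j, (a j : ℝ) * ‖z j‖ ^ (2 * (a j - 1))

end Brieskorn

end

/-! Write `p = ∑ z_j ^ a_j` and `ω = dα`. Since `α` is linear in the base point, `ω` has constant
coefficients, and a direct computation gives `ω(V₁, ·) = -Re dp` and `ω(V₂, ·) = -Im dp`. So `V₁`,
`V₂` are the Hamiltonian fields of the real and imaginary parts of `p`. They are tangent to the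
sphere where `p = 0`, and `ω(V₁, V₂) = μ`, which is positive because `z ≠ 0`. Hence the tangent
space of `B` is the `ω`-orthogonal complement of `V₁`, `V₂` in the tangent space of the sphere. Such
a complement inherits nondegeneracy (`nondegenerate_of_symplectic_pair`).

When `Z` kills `f` and `g`, the Jacobi bracket is `ω` of the horizontal Hamiltonian vectors
(`jacobiBracket_eq`). On the tangent space of `B`, the vector of `f|_B` has the same `ω`-pairings as
that of `f`. Projecting the vector of `g` along `V₁`, `V₂` therefore produces the correction term,
as in the Dirac bracket (`dForm_of_symplectic_pair`). -/

noncomputable section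

namespace ContactGeometry

variable {E : Type*} [NormedAddCommGroup E] [NormedSpace ℝ E]

/-! ### Tangent spaces of level sets and restriction of differentials. -/

/-- The tangent space of a regular level set is the kernel of the differential. -/
theorem mem_tangentSpaceAt_iff [FiniteDimensional ℝ E] {F : Type*} [NormedAddCommGroup F]
    [NormedSpace ℝ F] [FiniteDimensional ℝ F] {M : Set E} {Φ : E → F} {Φ' : E →L[ℝ] F} {x : E}
    (hM : M = {y | Φ y = 0}) (hx : x ∈ M) (hΦ : HasStrictFDerivAt Φ Φ' x)
    (hsurj : Function.Surjective Φ') (v : E) : v ∈ tangentSpaceAt M x ↔ Φ' v = 0 := by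
  subst hM
  have : CompleteSpace E := FiniteDimensional.complete ℝ E
  have : CompleteSpace F := FiniteDimensional.complete ℝ F
  constructor
  · rintro ⟨γ, h0, hγM, hγ⟩
    subst h0
    have h1 : HasDerivAt (fun t => Φ (γ t)) (Φ' v) 0 := hΦ.hasFDerivAt.comp_hasDerivAt 0 hγ
    have h2 : HasDerivAt (fun t => Φ (γ t)) 0 0 :=
      (hasDerivAt_const (0 : ℝ) (0 : F)).congr_of_eventuallyEq hγM
    exact h1.unique h2
  · intro hv
    have hr : Φ'.range = ⊤ := LinearMap.range_eq_top.2 hsurj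
    have hx0 : Φ x = 0 := hx
    let v' : Φ'.ker := ⟨v, hv⟩
    have hline : HasDerivAt (fun t : ℝ => t • v') v' 0 := by
      simpa using (hasDerivAt_id (0 : ℝ)).smul_const v'
    have hlim : Filter.Tendsto (fun t : ℝ => t • v') (𝓝 0) (𝓝 0) := by
      simpa using hline.continuousAt.tendsto
    -- The implicit function parametrizes the fibre through `x` by the kernel, with derivative at
    -- `0` the inclusion; the image of the line `t • v` therefore has velocity `v`.
    refine ⟨fun t => hΦ.implicitFunction Φ Φ' hr (Φ x) (t • v'), ?_, ?_, ?_⟩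
    · simp
    · have h := hΦ.map_implicitFunction_eq hr
      have h' : Filter.Tendsto (fun t : ℝ => (Φ x, t • v')) (𝓝 0) (𝓝 (Φ x, (0 : Φ'.ker))) :=
        tendsto_const_nhds.prodMk_nhds hlim
      filter_upwards [h'.eventually h] with t ht
      exact ht.trans hx0
    · have h := (hΦ.to_implicitFunction hr).hasFDerivAt
      have h2 : HasFDerivAt (hΦ.implicitFunction Φ Φ' hr (Φ x)) Φ'.ker.subtypeL
          ((0 : ℝ) • v') := by simpa using h
      exact h2.comp_hasDerivAt (0 : ℝ) hline

/-- On a tangent vector of a smaller set the differentials of a function on both sets agree. -/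
theorem differential_eq_of_subset {M N : Set E} (hMN : M ⊆ N) {f : E → ℝ} (hf : IsSmoothOn N f)
    {x v : E} (hx : x ∈ M) (hv : v ∈ tangentSpaceAt M x) :
    differential M f x v = differential N f x v := by
  obtain ⟨γ, h0, hγM, hγ⟩ := hv
  have hf' : IsSmoothOn M f := fun y hy => by
    obtain ⟨U, F, hU, hyU, hF, hEq⟩ := hf y (hMN hy)
    exact ⟨U, F, hU, hyU, hF, hEq.mono (Set.inter_subset_inter_right _ hMN)⟩
  exact (hasDerivAt_comp_curve hf' hx h0 hγM hγ).unique
    (hasDerivAt_comp_curve hf (hMN hx) h0 (hγM.mono fun _ h => hMN h) hγ)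

/-! ### Contact linear algebra at a point. -/

/-- `dForm` as a bilinear form. -/
def dFormBilin (α : E → E →L[ℝ] ℝ) (x : E) : E →ₗ[ℝ] E →ₗ[ℝ] ℝ :=
  LinearMap.mk₂ ℝ (dForm α x)
    (fun u v w => by simp only [dForm, map_add, add_apply]; ring)
    (fun c v w => by simp only [dForm, map_smul, smul_apply, smul_eq_mul]; ring)
    (fun u v w => by simp only [dForm, map_add, add_apply]; ring)
    (fun c v w => by simp only [dForm, map_smul, smul_apply, smul_eq_mul]; ring)

theorem dFormBilin_apply (α : E → E →L[ℝ] ℝ) (x v w : E) :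
    dFormBilin α x v w = dForm α x v w := rfl

theorem dForm_swap (α : E → E →L[ℝ] ℝ) (x v w : E) : dForm α x v w = - dForm α x w v := by
  simp [dForm]

/-- Linear algebra behind the existence of contact Hamiltonian vector fields. -/
theorem exists_horizontal [FiniteDimensional ℝ E] (T : Submodule ℝ E) (α : E →ₗ[ℝ] ℝ)
    (Ω : E →ₗ[ℝ] E →ₗ[ℝ] ℝ) (hΩ : ∀ v w, Ω v w = - Ω w v) {Z : E} (hZ : Z ∈ T) (hαZ : α Z = 1)
    (hΩZ : ∀ w ∈ T, Ω Z w = 0)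
    (hnd : ∀ v ∈ T, α v = 0 → (∀ w ∈ T, α w = 0 → Ω v w = 0) → v = 0) (D : E →ₗ[ℝ] ℝ) :
    ∃ Y ∈ T, α Y = 0 ∧ ∀ w ∈ T, - Ω Y w = D w - D Z * α w := by
  let H : Submodule ℝ E := T ⊓ LinearMap.ker α
  let L : H →ₗ[ℝ] Module.Dual ℝ H := (Ω.domRestrict₁₂ H H)
  have hL : ∀ v w : H, L v w = Ω v w := fun v w => rfl
  have hinj : Function.Injective L := by
    rw [← LinearMap.ker_eq_bot, LinearMap.ker_eq_bot']
    intro v hv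
    refine Subtype.ext (hnd v v.2.1 v.2.2 fun w hw hw0 => ?_)
    have := congrArg (fun l : Module.Dual ℝ H => l ⟨w, hw, hw0⟩) hv
    simpa [hL] using this
  have hsurj : Function.Surjective L :=
    -- Nondegeneracy makes `H → H*` injective, hence onto by dimension; `Y` solves the equation on
    -- `H`. On `Z` both sides vanish, and `T = H + ℝ Z`.
    (LinearMap.injective_iff_surjective_of_finrank_eq_finrank
      Subspace.dual_finrank_eq.symm).1 hinj
  obtain ⟨Y, hY⟩ := hsurj (-(D.domRestrict H))
  refine ⟨Y, Y.2.1, Y.2.2, fun w hw => ?_⟩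
  have hw' : w - α w • Z ∈ H :=
    ⟨T.sub_mem hw (T.smul_mem _ hZ), by simp [hαZ]⟩
  have h := congrArg (fun l : Module.Dual ℝ H => l ⟨_, hw'⟩) hY
  simp only [hL, LinearMap.neg_apply, LinearMap.domRestrict_apply, map_sub, map_smul,
    smul_eq_mul] at h
  have hYZ : Ω Y Z = 0 := by rw [hΩ, hΩZ _ Y.2.1, neg_zero]
  rw [hYZ] at h
  linarith

/-- The pointwise contact condition: `T` is the tangent space of `M` at `x` and `Z` is a
Reeb vector. -/
structure IsContactPoint (M : Set E) (α : E → E →L[ℝ] ℝ) (x : E) (T : Submodule ℝ E) (Z : E) :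
    Prop where
  mem_tangent : ∀ v, v ∈ tangentSpaceAt M x ↔ v ∈ T
  isReebAt : IsReebAt M α x Z
  nondegenerate : ∀ v ∈ T, α x v = 0 → (∀ w ∈ T, α x w = 0 → dForm α x v w = 0) → v = 0

namespace IsContactPoint

variable {M : Set E} {α : E → E →L[ℝ] ℝ} {x : E} {T : Submodule ℝ E} {Z : E}

theorem reeb_mem (h : IsContactPoint M α x T Z) : Z ∈ T := (h.mem_tangent _).1 h.isReebAt.1

theorem form_reeb (h : IsContactPoint M α x T Z) : α x Z = 1 := h.isReebAt.2.1

theorem dForm_reeb_left (h : IsContactPoint M α x T Z) {w : E} (hw : w ∈ T) :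
    dForm α x Z w = 0 := h.isReebAt.2.2 w ((h.mem_tangent w).2 hw)

theorem dForm_reeb_right (h : IsContactPoint M α x T Z) {w : E} (hw : w ∈ T) :
    dForm α x w Z = 0 := by rw [dForm_swap, h.dForm_reeb_left hw, neg_zero]

/-- The difference of two Reeb vectors is horizontal and `dα`-orthogonal to the tangent space, so
nondegeneracy makes the choice in `reeb` unique. -/
theorem reeb_eq (h : IsContactPoint M α x T Z) : reeb M α x = Z := by
  have hR : IsReebAt M α x (reeb M α x) := Classical.epsilon_spec ⟨Z, h.isReebAt⟩
  obtain ⟨h1, h2, h3⟩ := hR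
  refine sub_eq_zero.1 (h.nondegenerate _ (T.sub_mem ((h.mem_tangent _).1 h1) h.reeb_mem)
    (by rw [map_sub, h2, h.form_reeb, sub_self]) fun w hw _ => ?_)
  rw [← dFormBilin_apply, map_sub, LinearMap.sub_apply, dFormBilin_apply, dFormBilin_apply,
    h3 w ((h.mem_tangent w).2 hw), h.dForm_reeb_left hw, sub_self]

theorem horizontalHam_spec [FiniteDimensional ℝ E] (h : IsContactPoint M α x T Z) {f : E → ℝ}
    (hf : differential M f x Z = 0) :
    horizontalHam M α f x ∈ T ∧ α x (horizontalHam M α f x) = 0 ∧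
      ∀ w ∈ T, - dForm α x (horizontalHam M α f x) w = differential M f x w := by
  obtain ⟨Y, hYT, hY0, hY⟩ := exists_horizontal T (α x : E →ₗ[ℝ] ℝ) (dFormBilin α x)
    (dForm_swap α x) h.reeb_mem h.form_reeb (fun _ hw => h.dForm_reeb_left hw) h.nondegenerate
    (fderivWithin ℝ f M x : E →ₗ[ℝ] ℝ)
  have hspec := Classical.epsilon_spec (p := fun Y => Y ∈ tangentSpaceAt M x ∧ α x Y = 0 ∧
    ∀ w ∈ tangentSpaceAt M x, - dForm α x Y w =
      differential M f x w - differential M f x (reeb M α x) * α x w)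
    ⟨Y, (h.mem_tangent Y).2 hYT, hY0, fun w hw => by
      rw [h.reeb_eq]; exact hY w ((h.mem_tangent w).1 hw)⟩
  refine ⟨(h.mem_tangent _).1 hspec.1, hspec.2.1, fun w hw => ?_⟩
  have : - dForm α x (horizontalHam M α f x) w =
      differential M f x w - differential M f x (reeb M α x) * α x w :=
    hspec.2.2 w ((h.mem_tangent w).2 hw)
  rw [h.reeb_eq, hf, zero_mul, sub_zero] at this
  exact this

/-- Every term of the bracket containing `Z` drops out: the derivatives along `Z` vanish by
assumption, and `Z` is `dα`-orthogonal to all tangent vectors. -/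
theorem jacobiBracket_eq [FiniteDimensional ℝ E] (h : IsContactPoint M α x T Z) {f g : E → ℝ}
    (hf : differential M f x Z = 0) (hg : differential M g x Z = 0) :
    jacobiBracket M α f g x =
      dForm α x (horizontalHam M α f x) (horizontalHam M α g x) := by
  have hF := (h.horizontalHam_spec hf).1
  have hG := (h.horizontalHam_spec hg).1
  rw [jacobiBracket, contactHam, contactHam, h.reeb_eq, hf, hg, ← dFormBilin_apply]
  simp only [map_add, map_smul, LinearMap.add_apply, LinearMap.smul_apply, dFormBilin_apply,
    h.dForm_reeb_left hG, h.dForm_reeb_left h.reeb_mem, h.dForm_reeb_right hF, smul_zero,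
    mul_zero, sub_zero, add_zero, zero_add]

end IsContactPoint

/-! ### Reduction to the orthogonal complement of a symplectic pair. -/

/-- A codimension two subspace of a contact tangent space, cut out by `dα(V, ·) = dα(W, ·) = 0` with
`dα(V, W) ≠ 0`, is again nondegenerate. -/
theorem nondegenerate_of_symplectic_pair {α : E → E →L[ℝ] ℝ} {x : E} {T T' : Submodule ℝ E}
    {V W Z : E} (hZ : Z ∈ T) (hαZ : α x Z = 1) (hωZ : ∀ w ∈ T, dForm α x Z w = 0)
    (hnd : ∀ v ∈ T, α x v = 0 → (∀ w ∈ T, α x w = 0 → dForm α x v w = 0) → v = 0)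
    (hV : V ∈ T) (hW : W ∈ T) (hVW : dForm α x V W ≠ 0)
    (hT' : ∀ v, v ∈ T' ↔ v ∈ T ∧ dForm α x V v = 0 ∧ dForm α x W v = 0) :
    ∀ v ∈ T', α x v = 0 → (∀ w ∈ T', α x w = 0 → dForm α x v w = 0) → v = 0 := by
  intro v hv hv0 h
  obtain ⟨hvT, hVv, hWv⟩ := (hT' v).1 hv
  refine hnd v hvT hv0 fun w hw hw0 => ?_
  set c := dForm α x V W with hc
  have hsw := dForm_swap α x
  have hself : ∀ u, dForm α x u u = 0 := fun u => by simp [dForm]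
  -- `p` and `q` make `u` orthogonal to `V` and `W`. As these need not be horizontal, a multiple of
  -- `Z` is then removed from `u`. No correction changes the pairing with `v`.
  let p := dForm α x W w / c
  let q := - dForm α x V w / c
  let u := w + p • V + q • W
  have huT : u ∈ T := T.add_mem (T.add_mem hw (T.smul_mem _ hV)) (T.smul_mem _ hW)
  have hωu : ∀ y, dForm α x y u = dForm α x y w + p * dForm α x y V + q * dForm α x y W := by
    intro y
    simp only [← dFormBilin_apply, u, map_add, map_smul, smul_eq_mul]
  have hωs : ∀ y, dForm α x y (u - α x u • Z) = dForm α x y u - α x u * dForm α x y Z := by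
    intro y
    simp only [← dFormBilin_apply, map_sub, map_smul, smul_eq_mul]
  have hyZ : ∀ y ∈ T, dForm α x y Z = 0 := fun y hy => by rw [hsw, hωZ y hy, neg_zero]
  have key := h (u - α x u • Z) ((hT' _).2 ⟨T.sub_mem huT (T.smul_mem _ hZ), by
    rw [hωs, hωu, hself, ← hc, hyZ V hV]; simp only [q]; field_simp; ring, by
    rw [hωs, hωu, hself, hsw W V, ← hc, hyZ W hW]; simp only [p]; field_simp; ring⟩)
    (by simp [hαZ])
  rw [hωs, hωu, hyZ v hvT, hsw v V, hsw v W, hVv, hWv] at key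
  simpa using key

/-- Comparison of the horizontal Hamiltonian vectors on a contact tangent space with those on a
codimension two subspace. -/
theorem dForm_of_symplectic_pair {α : E → E →L[ℝ] ℝ} {x : E} {T T' : Submodule ℝ E}
    {V W : E} (hV : V ∈ T) (hW : W ∈ T) (hVW : dForm α x V W ≠ 0)
    (hT' : ∀ v, v ∈ T' ↔ v ∈ T ∧ dForm α x V v = 0 ∧ dForm α x W v = 0)
    {F G F' G' : E} (hG : G ∈ T) (hF' : F' ∈ T')
    (hFF : ∀ w ∈ T', dForm α x F' w = dForm α x F w)
    (hGG : ∀ w ∈ T', dForm α x G' w = dForm α x G w) :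
    dForm α x F' G' = dForm α x F G +
      (dForm α x F W * dForm α x G V - dForm α x F V * dForm α x G W) / dForm α x V W := by
  set c := dForm α x V W with hc
  have hsw := dForm_swap α x
  have hself : ∀ u, dForm α x u u = 0 := fun u => by simp [dForm]
  -- `C` is the projection of `G` to `T'` along `V`, `W`. Pairing with `F' ∈ T'` does not see the
  -- difference, so `ω(F', G') = ω(F', G) = ω(F', C) = ω(F, C)`.
  let C : E := G + (dForm α x W G / c) • V + (- dForm α x V G / c) • W
  have hCT : C ∈ T := T.add_mem (T.add_mem hG (T.smul_mem _ hV)) (T.smul_mem _ hW)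
  have hωC : ∀ y, dForm α x y C = dForm α x y G + (dForm α x W G / c) * dForm α x y V
      + (- dForm α x V G / c) * dForm α x y W := by
    intro y
    simp only [← dFormBilin_apply, C, map_add, map_smul, smul_eq_mul]
  have hC' : C ∈ T' := (hT' _).2 ⟨hCT, by rw [hωC, hself, ← hc]; field_simp; ring,
    by rw [hωC, hself, hsw W V, ← hc]; field_simp; ring⟩
  obtain ⟨-, hVF, hWF⟩ := (hT' _).1 hF'
  have h1 : dForm α x F' C = dForm α x F' G := by
    rw [hωC, hsw F' V, hsw F' W, hVF, hWF]; ring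
  rw [hsw, hGG F' hF', ← hsw, ← h1, hFF C hC', hωC, hsw W G, hsw V G]
  field_simp
  ring

end ContactGeometry
end

noncomputable section
open ContactGeometry

namespace Brieskorn

variable {n : ℕ}

/-! ### The form, the defining equations and their derivatives in coordinates. -/

theorem form_apply (a : Fin (n + 1) → ℕ) (z v : Fin (n + 1) → ℂ) :
    form a z v = (1 / 4 : ℝ) * ∑ j, (a j : ℝ) * ((z j).re * (v j).im - (z j).im * (v j).re) := by
  simp [form]

/-- `form` depends linearly on the base point. -/
def formLinear (a : Fin (n + 1) → ℕ) : (Fin (n + 1) → ℂ) →ₗ[ℝ] (Fin (n + 1) → ℂ) →L[ℝ] ℝ where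
  toFun := form a
  map_add' z w := by
    ext v
    simp only [form_apply, add_apply, Pi.add_apply, Complex.add_re, Complex.add_im, ← mul_add,
      ← Finset.sum_add_distrib]
    congr 1
    exact Finset.sum_congr rfl fun j _ => by ring
  map_smul' c z := by
    ext v
    simp only [form_apply, smul_apply, Pi.smul_apply, Complex.smul_re, Complex.smul_im,
      smul_eq_mul, RingHom.id_apply, Finset.mul_sum]
    exact Finset.sum_congr rfl fun j _ => by ring

theorem contDiff_form (a : Fin (n + 1) → ℕ) : ContDiff ℝ ∞ (form a) :=
  (LinearMap.toContinuousLinearMap (formLinear a)).contDiff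

/-- A form linear in the base point is its own derivative, so `dα` does not depend on `z`. -/
theorem dForm_form (a : Fin (n + 1) → ℕ) (z v w : Fin (n + 1) → ℂ) :
    dForm (form a) z v w =
      (1 / 2 : ℝ) * ∑ j, (a j : ℝ) * ((v j).re * (w j).im - (v j).im * (w j).re) := by
  have h : fderiv ℝ (form a) z = LinearMap.toContinuousLinearMap (formLinear a) :=
    (LinearMap.toContinuousLinearMap (formLinear a)).fderiv
  have h' : ∀ u, LinearMap.toContinuousLinearMap (formLinear a) u = form a u := fun _ => rfl
  rw [dForm, h, h', h', form_apply, form_apply, ← mul_sub, ← Finset.sum_sub_distrib,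
    Finset.mul_sum, Finset.mul_sum]
  exact Finset.sum_congr rfl fun j _ => by ring

/-- Half the differential of `∑ |z_j|²`. -/
def radialForm (z : Fin (n + 1) → ℂ) : (Fin (n + 1) → ℂ) →L[ℝ] ℝ :=
  ∑ j, (innerSL ℝ (z j)) ∘L ContinuousLinearMap.proj (R := ℝ) (φ := fun _ => ℂ) j

theorem radialForm_apply (z v : Fin (n + 1) → ℂ) :
    radialForm z v = ∑ j, ((z j).re * (v j).re + (z j).im * (v j).im) := by
  simp only [radialForm, sum_apply, ContinuousLinearMap.comp_apply,
    ContinuousLinearMap.proj_apply, innerSL_apply_apply, Complex.inner, Complex.mul_re,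
    Complex.conj_re, Complex.conj_im]
  exact Finset.sum_congr rfl fun j _ => by ring

/-- The differential of `∑ z_j ^ a_j`. -/
def powForm (a : Fin (n + 1) → ℕ) (z : Fin (n + 1) → ℂ) : (Fin (n + 1) → ℂ) →L[ℝ] ℂ :=
  ∑ j, (a j • z j ^ (a j - 1)) • ContinuousLinearMap.proj (R := ℝ) (φ := fun _ => ℂ) j

theorem powForm_apply (a : Fin (n + 1) → ℕ) (z v : Fin (n + 1) → ℂ) :
    powForm a z v = ∑ j, a j * z j ^ (a j - 1) * v j := by
  simp [powForm]

theorem hasStrictFDerivAt_sum_norm_sq (z : Fin (n + 1) → ℂ) :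
    HasStrictFDerivAt (fun w : Fin (n + 1) → ℂ => ∑ j, ‖w j‖ ^ 2 - 1)
      ((2 : ℝ) • radialForm z) z := by
  have h : HasStrictFDerivAt (fun w : Fin (n + 1) → ℂ => ∑ j, ‖w j‖ ^ 2)
      (∑ j, (2 • innerSL ℝ (z j)) ∘L
        ContinuousLinearMap.proj (R := ℝ) (φ := fun _ => ℂ) j) z :=
    HasStrictFDerivAt.fun_sum fun j _ => (hasStrictFDerivAt_norm_sq (z j)).comp z
      (ContinuousLinearMap.proj (R := ℝ) (φ := fun _ => ℂ) j).hasStrictFDerivAt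
  refine (h.sub_const 1).congr_fderiv ?_
  ext v
  simp [radialForm, two_smul, Finset.sum_add_distrib]

theorem hasStrictFDerivAt_sum_pow (a : Fin (n + 1) → ℕ) (z : Fin (n + 1) → ℂ) :
    HasStrictFDerivAt (fun w : Fin (n + 1) → ℂ => ∑ j, w j ^ a j) (powForm a z) z :=
  HasStrictFDerivAt.fun_sum fun j _ =>
    (ContinuousLinearMap.proj (R := ℝ) (φ := fun _ => ℂ) j).hasStrictFDerivAt.pow (a j)

theorem contDiff_sum_norm_sq :
    ContDiff ℝ ∞ (fun w : Fin (n + 1) → ℂ => ∑ j, ‖w j‖ ^ 2 - 1) :=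
  (ContDiff.sum fun j _ => (contDiff_apply ℝ ℂ j).norm_sq ℝ).sub contDiff_const

theorem contDiff_sum_pow (a : Fin (n + 1) → ℕ) :
    ContDiff ℝ ∞ (fun w : Fin (n + 1) → ℂ => ∑ j, w j ^ a j) :=
  ContDiff.sum fun j _ => (contDiff_apply ℝ ℂ j).pow _

theorem sum_norm_sq_eq (z : Fin (n + 1) → ℂ) : ∑ j, ‖z j‖ ^ 2 = radialForm z z := by
  rw [radialForm_apply]
  exact Finset.sum_congr rfl fun j _ => by rw [Complex.sq_norm, Complex.normSq_apply]

/-- The equation of the sphere. -/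
def sphereMap (z : Fin (n + 1) → ℂ) : Fin 1 → ℝ := fun _ => ∑ j, ‖z j‖ ^ 2 - 1

/-- The equations of the Brieskorn manifold. -/
def brieskornMap (a : Fin (n + 1) → ℕ) (z : Fin (n + 1) → ℂ) : Fin 3 → ℝ :=
  ![∑ j, ‖z j‖ ^ 2 - 1, (∑ j, z j ^ a j).re, (∑ j, z j ^ a j).im]

def sphereDeriv (z : Fin (n + 1) → ℂ) : (Fin (n + 1) → ℂ) →L[ℝ] (Fin 1 → ℝ) :=
  ContinuousLinearMap.pi fun _ => (2 : ℝ) • radialForm z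

def brieskornDeriv (a : Fin (n + 1) → ℕ) (z : Fin (n + 1) → ℂ) :
    (Fin (n + 1) → ℂ) →L[ℝ] (Fin 3 → ℝ) :=
  ContinuousLinearMap.pi ![(2 : ℝ) • radialForm z, Complex.reCLM ∘L powForm a z,
    Complex.imCLM ∘L powForm a z]

theorem hasStrictFDerivAt_sphereMap (z : Fin (n + 1) → ℂ) :
    HasStrictFDerivAt sphereMap (sphereDeriv z) z :=
  hasStrictFDerivAt_pi.2 fun _ => hasStrictFDerivAt_sum_norm_sq z

theorem hasStrictFDerivAt_brieskornMap (a : Fin (n + 1) → ℕ) (z : Fin (n + 1) → ℂ) :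
    HasStrictFDerivAt (brieskornMap a) (brieskornDeriv a z) z := by
  refine hasStrictFDerivAt_pi'.2 fun i => ?_
  fin_cases i
  · exact hasStrictFDerivAt_sum_norm_sq z
  · exact Complex.reCLM.hasStrictFDerivAt.comp z (hasStrictFDerivAt_sum_pow a z)
  · exact Complex.imCLM.hasStrictFDerivAt.comp z (hasStrictFDerivAt_sum_pow a z)

theorem contDiff_sphereMap : ContDiff ℝ ∞ (sphereMap (n := n)) :=
  contDiff_pi.2 fun _ => contDiff_sum_norm_sq

theorem contDiff_brieskornMap (a : Fin (n + 1) → ℕ) : ContDiff ℝ ∞ (brieskornMap a) := by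
  refine contDiff_pi.2 fun i => ?_
  fin_cases i
  · exact contDiff_sum_norm_sq
  · exact Complex.reCLM.contDiff.comp (contDiff_sum_pow a)
  · exact Complex.imCLM.contDiff.comp (contDiff_sum_pow a)

theorem unitSphere_eq : unitSphere n = {z | sphereMap z = 0} := by
  ext z
  simp [unitSphere, sphereMap, funext_iff, sub_eq_zero]

theorem manifold_eq (a : Fin (n + 1) → ℕ) : manifold a = {z | brieskornMap a z = 0} := by
  ext z
  simp only [manifold, brieskornMap, Set.mem_ofPred_eq, funext_iff, Fin.forall_fin_succ,
    Complex.ext_iff (z := ∑ j, z j ^ a j)]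
  simp [sub_eq_zero]

theorem manifold_subset (a : Fin (n + 1) → ℕ) : manifold a ⊆ unitSphere n := fun _ h => h.1

theorem sphereDeriv_eq_zero_iff (z v : Fin (n + 1) → ℂ) :
    sphereDeriv z v = 0 ↔ radialForm z v = 0 := by
  simp [sphereDeriv, funext_iff]

theorem brieskornDeriv_eq_zero_iff (a : Fin (n + 1) → ℕ) (z v : Fin (n + 1) → ℂ) :
    brieskornDeriv a z v = 0 ↔ radialForm z v = 0 ∧ powForm a z v = 0 := by
  simp [brieskornDeriv, funext_iff, Fin.forall_fin_succ, Complex.ext_iff]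

theorem finrank_euclidean : Module.finrank ℝ (Fin (n + 1) → ℂ) = 2 * (n + 1) := by
  rw [finrank_real_of_complex, Module.finrank_fin_fun]

/-! ### The vectors `V₁`, `V₂` and the Reeb field -/

theorem powForm_V₁ (a : Fin (n + 1) → ℕ) (z : Fin (n + 1) → ℂ) :
    powForm a z (V₁ a z) = Complex.I * mu a z := by
  simp only [powForm_apply, V₁, mu]
  push_cast
  simp only [Finset.mul_sum]
  refine Finset.sum_congr rfl fun j _ => ?_
  have : z j ^ (a j - 1) * (starRingEnd ℂ (z j)) ^ (a j - 1) = (‖z j‖ : ℂ) ^ (2 * (a j - 1)) := by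
    rw [← mul_pow, Complex.mul_conj', pow_mul]
  linear_combination (2 * Complex.I * a j) * this

/-- Follows from `V₂ = i V₁` and complex linearity of `dp`. -/
theorem powForm_V₂ (a : Fin (n + 1) → ℕ) (z : Fin (n + 1) → ℂ) :
    powForm a z (V₂ a z) = - mu a z := by
  have h : V₂ a z = fun j => Complex.I * V₁ a z j := by
    funext j
    simp only [V₁, V₂]
    linear_combination (-2 * (starRingEnd ℂ (z j)) ^ (a j - 1)) * Complex.I_mul_I
  have h2 : powForm a z (V₂ a z) = Complex.I * powForm a z (V₁ a z) := by
    rw [h, powForm_apply, powForm_apply, Finset.mul_sum]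
    exact Finset.sum_congr rfl fun j _ => by ring
  rw [h2, powForm_V₁, ← mul_assoc, Complex.I_mul_I]
  ring

theorem dForm_V₁ (a : Fin (n + 1) → ℕ) (x z w : Fin (n + 1) → ℂ) :
    dForm (form a) x (V₁ a z) w = - (powForm a z w).re := by
  rw [dForm_form, powForm_apply, Complex.re_sum, Finset.mul_sum, ← Finset.sum_neg_distrib]
  refine Finset.sum_congr rfl fun j _ => ?_
  have : (starRingEnd ℂ (z j)) ^ (a j - 1) = starRingEnd ℂ (z j ^ (a j - 1)) := by rw [map_pow]
  simp only [V₁, this]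
  generalize z j ^ (a j - 1) = u
  simp
  ring

theorem dForm_V₂ (a : Fin (n + 1) → ℕ) (x z w : Fin (n + 1) → ℂ) :
    dForm (form a) x (V₂ a z) w = - (powForm a z w).im := by
  rw [dForm_form, powForm_apply, Complex.im_sum, Finset.mul_sum, ← Finset.sum_neg_distrib]
  refine Finset.sum_congr rfl fun j _ => ?_
  have : (starRingEnd ℂ (z j)) ^ (a j - 1) = starRingEnd ℂ (z j ^ (a j - 1)) := by rw [map_pow]
  simp only [V₂, this]
  generalize z j ^ (a j - 1) = u
  simp
  ring

theorem dForm_V₁_V₂ (a : Fin (n + 1) → ℕ) (x z : Fin (n + 1) → ℂ) :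
    dForm (form a) x (V₁ a z) (V₂ a z) = mu a z := by
  simp [dForm_V₁, powForm_V₂]

/-- Pairing with `z_j` restores the full power `z_j ^ a_j` (here `a_j > 0` is needed), so the radial
component is `2 Im p`; for `V₂` it is `-2 Re p`. -/
theorem radialForm_V₁ {a : Fin (n + 1) → ℕ} (ha : ∀ j, 0 < a j) {z : Fin (n + 1) → ℂ}
    (hz : ∑ j, z j ^ a j = 0) : radialForm z (V₁ a z) = 0 := by
  have h : radialForm z (V₁ a z) = 2 * (∑ j, z j ^ a j).im := by
    rw [radialForm_apply, Complex.im_sum, Finset.mul_sum]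
    refine Finset.sum_congr rfl fun j _ => ?_
    have h1 : (starRingEnd ℂ (z j)) ^ (a j - 1) = starRingEnd ℂ (z j ^ (a j - 1)) := by
      rw [map_pow]
    have h2 : z j ^ a j = z j ^ (a j - 1) * z j := (pow_sub_one_mul (ha j).ne' _).symm
    simp only [V₁, h1, h2]
    generalize z j ^ (a j - 1) = u
    simp
    ring
  simp [h, hz]

theorem radialForm_V₂ {a : Fin (n + 1) → ℕ} (ha : ∀ j, 0 < a j) {z : Fin (n + 1) → ℂ}
    (hz : ∑ j, z j ^ a j = 0) : radialForm z (V₂ a z) = 0 := by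
  have h : radialForm z (V₂ a z) = -2 * (∑ j, z j ^ a j).re := by
    rw [radialForm_apply, Complex.re_sum, Finset.mul_sum]
    refine Finset.sum_congr rfl fun j _ => ?_
    have h1 : (starRingEnd ℂ (z j)) ^ (a j - 1) = starRingEnd ℂ (z j ^ (a j - 1)) := by
      rw [map_pow]
    have h2 : z j ^ a j = z j ^ (a j - 1) * z j := (pow_sub_one_mul (ha j).ne' _).symm
    simp only [V₂, h1, h2]
    generalize z j ^ (a j - 1) = u
    simp
    ring
  simp [h, hz]

theorem mu_ne_zero {a : Fin (n + 1) → ℕ} (ha : ∀ j, 0 < a j) {z : Fin (n + 1) → ℂ} (hz : z ≠ 0) :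
    mu a z ≠ 0 := by
  obtain ⟨j, hj⟩ := Function.ne_iff.1 hz
  have hj' : 0 < ‖z j‖ := norm_pos_iff.2 hj
  have haj : (0 : ℝ) < a j := Nat.cast_pos.2 (ha j)
  refine (mul_pos two_pos (Finset.sum_pos' (fun i _ => by positivity)
    ⟨j, Finset.mem_univ j, by positivity⟩)).ne'

theorem ne_zero_of_mem_unitSphere {z : Fin (n + 1) → ℂ} (hz : z ∈ unitSphere n) : z ≠ 0 := by
  rintro rfl
  simp [unitSphere] at hz

theorem reebField_re (a : Fin (n + 1) → ℕ) (z : Fin (n + 1) → ℂ) (j : Fin (n + 1)) :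
    (reebField a z j).re = - (4 / a j * (z j).im) := by
  have : reebField a z j = ((4 / a j : ℝ) : ℂ) * (Complex.I * z j) := by
    simp only [reebField]; push_cast; ring
  rw [this, Complex.re_ofReal_mul]
  simp

theorem reebField_im (a : Fin (n + 1) → ℕ) (z : Fin (n + 1) → ℂ) (j : Fin (n + 1)) :
    (reebField a z j).im = 4 / a j * (z j).re := by
  have : reebField a z j = ((4 / a j : ℝ) : ℂ) * (Complex.I * z j) := by
    simp only [reebField]; push_cast; ring
  rw [this, Complex.im_ofReal_mul]
  simp

theorem radialForm_reebField (a : Fin (n + 1) → ℕ) (z : Fin (n + 1) → ℂ) :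
    radialForm z (reebField a z) = 0 := by
  rw [radialForm_apply]
  exact Finset.sum_eq_zero fun j _ => by rw [reebField_re, reebField_im]; ring

/-- Weighted homogeneity: the flow of `Z` multiplies `z_j` by `exp(4it / a_j)`, hence `p` by
`exp(4it)`. -/
theorem powForm_reebField {a : Fin (n + 1) → ℕ} (ha : ∀ j, 0 < a j) (z : Fin (n + 1) → ℂ) :
    powForm a z (reebField a z) = 4 * Complex.I * ∑ j, z j ^ a j := by
  rw [powForm_apply, Finset.mul_sum]
  refine Finset.sum_congr rfl fun j _ => ?_
  have h : (a j : ℂ) ≠ 0 := Nat.cast_ne_zero.2 (ha j).ne'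
  rw [← pow_sub_one_mul (ha j).ne' (z j), reebField]
  field_simp

theorem form_reebField {a : Fin (n + 1) → ℕ} (ha : ∀ j, 0 < a j) (z : Fin (n + 1) → ℂ) :
    form a z (reebField a z) = radialForm z z := by
  rw [form_apply, radialForm_apply, Finset.mul_sum]
  refine Finset.sum_congr rfl fun j _ => ?_
  have h : (a j : ℝ) ≠ 0 := Nat.cast_ne_zero.2 (ha j).ne'
  rw [reebField_re, reebField_im]
  field_simp
  ring

theorem dForm_reebField {a : Fin (n + 1) → ℕ} (ha : ∀ j, 0 < a j) (z w : Fin (n + 1) → ℂ) :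
    dForm (form a) z (reebField a z) w = -2 * radialForm z w := by
  rw [dForm_form, radialForm_apply, Finset.mul_sum, Finset.mul_sum]
  refine Finset.sum_congr rfl fun j _ => ?_
  have h : (a j : ℝ) ≠ 0 := Nat.cast_ne_zero.2 (ha j).ne'
  rw [reebField_re, reebField_im]
  field_simp
  ring

/-! ### Tangent spaces and nondegeneracy -/

/-- The tangent space of the sphere. -/
def sphereTangent (z : Fin (n + 1) → ℂ) : Submodule ℝ (Fin (n + 1) → ℂ) :=
  LinearMap.ker (radialForm z : (Fin (n + 1) → ℂ) →ₗ[ℝ] ℝ)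

/-- The tangent space of the Brieskorn manifold. -/
def brieskornTangent (a : Fin (n + 1) → ℕ) (z : Fin (n + 1) → ℂ) :
    Submodule ℝ (Fin (n + 1) → ℂ) :=
  sphereTangent z ⊓ LinearMap.ker (powForm a z : (Fin (n + 1) → ℂ) →ₗ[ℝ] ℂ)

theorem mem_sphereTangent {z v : Fin (n + 1) → ℂ} :
    v ∈ sphereTangent z ↔ radialForm z v = 0 := Iff.rfl

theorem mem_brieskornTangent {a : Fin (n + 1) → ℕ} {z v : Fin (n + 1) → ℂ} :
    v ∈ brieskornTangent a z ↔ radialForm z v = 0 ∧ powForm a z v = 0 := Iff.rfl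

theorem sphereDeriv_surjective {z : Fin (n + 1) → ℂ} (hz : z ∈ unitSphere n) :
    Function.Surjective (sphereDeriv z) := by
  have h1 : radialForm z z = 1 := by rw [← sum_norm_sq_eq]; exact hz
  intro y
  refine ⟨(y 0 / 2) • z, ?_⟩
  funext i
  rw [Subsingleton.elim i 0]
  simp [sphereDeriv, h1]

theorem brieskornDeriv_surjective {a : Fin (n + 1) → ℕ} (ha : ∀ j, 0 < a j)
    {z : Fin (n + 1) → ℂ} (hz : z ∈ manifold a) : Function.Surjective (brieskornDeriv a z) := by
  have h1 : radialForm z z = 1 := by rw [← sum_norm_sq_eq]; exact hz.1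
  have hmu := mu_ne_zero ha (ne_zero_of_mem_unitSphere (manifold_subset a hz))
  intro y
  let p := powForm a z ((y 0 / 2) • z)
  -- The multiple of `z` gives the radial value and contributes `p` to the other two. `V₁` and `V₂`
  -- then adjust the imaginary and real parts without touching the radial one.
  refine ⟨(y 0 / 2) • z + ((y 2 - p.im) / mu a z) • V₁ a z
    + (- (y 1 - p.re) / mu a z) • V₂ a z, ?_⟩
  have hr : radialForm z ((y 0 / 2) • z + ((y 2 - p.im) / mu a z) • V₁ a z
    + (- (y 1 - p.re) / mu a z) • V₂ a z) = y 0 / 2 := by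
    rw [map_add, map_add, map_smul, map_smul, map_smul, radialForm_V₁ ha hz.2,
      radialForm_V₂ ha hz.2, h1]
    simp
  have hp : powForm a z ((y 0 / 2) • z + ((y 2 - p.im) / mu a z) • V₁ a z
    + (- (y 1 - p.re) / mu a z) • V₂ a z) = ⟨y 1, y 2⟩ := by
    rw [map_add, map_add, map_smul _ _ (V₁ a z), map_smul _ _ (V₂ a z), powForm_V₁, powForm_V₂]
    change p + _ + _ = _
    apply Complex.ext <;> simp <;> field_simp <;> ring
  funext i
  fin_cases i
  · change 2 * radialForm z _ = y 0
    rw [hr]; ring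
  · change (powForm a z _).re = y 1
    rw [hp]
  · change (powForm a z _).im = y 2
    rw [hp]

theorem mem_tangentSpaceAt_unitSphere {z : Fin (n + 1) → ℂ} (hz : z ∈ unitSphere n)
    (v : Fin (n + 1) → ℂ) : v ∈ tangentSpaceAt (unitSphere n) z ↔ v ∈ sphereTangent z :=
  (mem_tangentSpaceAt_iff unitSphere_eq hz (hasStrictFDerivAt_sphereMap z)
    (sphereDeriv_surjective hz) v).trans (sphereDeriv_eq_zero_iff z v)

theorem mem_tangentSpaceAt_manifold {a : Fin (n + 1) → ℕ} (ha : ∀ j, 0 < a j)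
    {z : Fin (n + 1) → ℂ} (hz : z ∈ manifold a) (v : Fin (n + 1) → ℂ) :
    v ∈ tangentSpaceAt (manifold a) z ↔ v ∈ brieskornTangent a z :=
  (mem_tangentSpaceAt_iff (manifold_eq a) hz (hasStrictFDerivAt_brieskornMap a z)
    (brieskornDeriv_surjective ha hz) v).trans (brieskornDeriv_eq_zero_iff a z v)

/-- This puts the tangent space of `B` in the form required by the symplectic pair lemmas. -/
theorem mem_brieskornTangent_iff {a : Fin (n + 1) → ℕ} (z v : Fin (n + 1) → ℂ) :
    v ∈ brieskornTangent a z ↔ v ∈ sphereTangent z ∧ dForm (form a) z (V₁ a z) v = 0 ∧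
      dForm (form a) z (V₂ a z) v = 0 := by
  rw [mem_brieskornTangent, mem_sphereTangent, dForm_V₁, dForm_V₂, neg_eq_zero, neg_eq_zero,
    Complex.ext_iff, Complex.zero_re, Complex.zero_im]

theorem isSubmanifold_unitSphere : IsSubmanifold (unitSphere n) (2 * n + 1) := by
  intro z hz
  refine ⟨1, Set.univ, sphereMap, by rw [finrank_euclidean]; ring, isOpen_univ, Set.mem_univ z,
    contDiff_sphereMap.contDiffOn, ?_, by simp [unitSphere_eq]⟩
  rw [(hasStrictFDerivAt_sphereMap z).hasFDerivAt.fderiv]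
  exact sphereDeriv_surjective hz

/-- For `n = 0` the Brieskorn manifold is empty. -/
theorem pos_of_mem_manifold {a : Fin (n + 1) → ℕ} {z : Fin (n + 1) → ℂ} (hz : z ∈ manifold a) :
    0 < n := by
  rcases Nat.eq_zero_or_pos n with rfl | h
  · have h1 : ∑ j : Fin 1, ‖z j‖ ^ 2 = 1 := hz.1
    have h2 : ∑ j : Fin 1, z j ^ a j = 0 := hz.2
    rw [Fin.sum_univ_one] at h1 h2
    rw [eq_zero_of_pow_eq_zero h2] at h1
    simp at h1
  · exact h

theorem isSubmanifold_manifold {a : Fin (n + 1) → ℕ} (ha : ∀ j, 0 < a j) :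
    IsSubmanifold (manifold a) (2 * (n - 1) + 1) := by
  intro z hz
  have hn := pos_of_mem_manifold hz
  -- The truncated `n - 1` is harmless: a point of `B` forces `n > 0`, so `3 + (2 * (n - 1) + 1) = 2
  -- * (n + 1)`.
  refine ⟨3, Set.univ, brieskornMap a, by rw [finrank_euclidean]; lia, isOpen_univ,
    Set.mem_univ z, (contDiff_brieskornMap a).contDiffOn, ?_, by simp [manifold_eq]⟩
  rw [(hasStrictFDerivAt_brieskornMap a z).hasFDerivAt.fderiv]
  exact brieskornDeriv_surjective ha hz

theorem sphere_nondegenerate {a : Fin (n + 1) → ℕ} (ha : ∀ j, 0 < a j) {z : Fin (n + 1) → ℂ}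
    (hz : z ∈ unitSphere n) : ∀ v ∈ sphereTangent z, form a z v = 0 →
      (∀ w ∈ sphereTangent z, form a z w = 0 → dForm (form a) z v w = 0) → v = 0 := by
  intro v hv hv0 h
  have h1 : radialForm z z = 1 := by rw [← sum_norm_sq_eq]; exact hz
  let Z := reebField a z
  have hZT : radialForm z Z = 0 := radialForm_reebField a z
  have hαZ : form a z Z = 1 := (form_reebField ha z).trans h1
  have hvZ : dForm (form a) z v Z = 0 := by
    rw [dForm_swap, dForm_reebField ha, mem_sphereTangent.1 hv]; simp
  have hvz : dForm (form a) z v z = 0 := by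
    have : dForm (form a) z v z = -2 * form a z v := by
      rw [dForm_form, form_apply, Finset.mul_sum, Finset.mul_sum, Finset.mul_sum]
      exact Finset.sum_congr rfl fun j _ => by ring
    rw [this, hv0, mul_zero]
  -- Testing `v` against `i v` gives a positive definite sum. Subtracting multiples of `z` and `Z`
  -- makes `i v` tangent and horizontal; both are `dα`-orthogonal to `v`, since `dα(v, z) = -2 α(v)`
  -- and `v` is tangent.
  let u : Fin (n + 1) → ℂ := fun j => Complex.I * v j
  have hvu : dForm (form a) z v u = (1 / 2 : ℝ) * ∑ j, (a j : ℝ) * ‖v j‖ ^ 2 := by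
    rw [dForm_form]
    congr 1
    refine Finset.sum_congr rfl fun j _ => ?_
    rw [Complex.sq_norm, Complex.normSq_apply]
    simp only [u, Complex.mul_re, Complex.mul_im, Complex.I_re, Complex.I_im]
    ring
  let w := u - radialForm z u • z
  have hw : radialForm z w = 0 := by simp [w, h1]
  have key := h (w - form a z w • Z)
    (mem_sphereTangent.2 (by rw [map_sub, map_smul, hw, hZT]; simp))
    (by rw [map_sub, map_smul, hαZ]; simp)
  simp only [w, ← dFormBilin_apply, map_sub, map_smul] at key
  simp only [dFormBilin_apply, hvZ, hvz, smul_zero, sub_zero, hvu] at key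
  have hsum : ∑ j, (a j : ℝ) * ‖v j‖ ^ 2 = 0 := by linarith
  funext j
  have := (Finset.sum_eq_zero_iff_of_nonneg fun j _ => by positivity).1 hsum j (Finset.mem_univ j)
  have haj : (a j : ℝ) ≠ 0 := Nat.cast_ne_zero.2 (ha j).ne'
  simpa [haj] using this

theorem isContactPoint_unitSphere {a : Fin (n + 1) → ℕ} (ha : ∀ j, 0 < a j)
    {z : Fin (n + 1) → ℂ} (hz : z ∈ unitSphere n) :
    IsContactPoint (unitSphere n) (form a) z (sphereTangent z) (reebField a z) where
  mem_tangent := mem_tangentSpaceAt_unitSphere hz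
  isReebAt := by
    refine ⟨(mem_tangentSpaceAt_unitSphere hz _).2 (radialForm_reebField a z), ?_, fun w hw => ?_⟩
    · rw [form_reebField ha, ← sum_norm_sq_eq]; exact hz
    · rw [dForm_reebField ha, mem_sphereTangent.1 ((mem_tangentSpaceAt_unitSphere hz w).1 hw)]
      simp
  nondegenerate := sphere_nondegenerate ha hz

theorem isContactPoint_manifold {a : Fin (n + 1) → ℕ} (ha : ∀ j, 0 < a j)
    {z : Fin (n + 1) → ℂ} (hz : z ∈ manifold a) :
    IsContactPoint (manifold a) (form a) z (brieskornTangent a z) (reebField a z) := by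
  have hS := isContactPoint_unitSphere ha (manifold_subset a hz)
  have hmu := mu_ne_zero ha (ne_zero_of_mem_unitSphere (manifold_subset a hz))
  refine ⟨mem_tangentSpaceAt_manifold ha hz, ⟨(mem_tangentSpaceAt_manifold ha hz _).2
    (mem_brieskornTangent.2 ⟨radialForm_reebField a z, ?_⟩), hS.form_reeb, fun w hw =>
      hS.dForm_reeb_left ((mem_tangentSpaceAt_manifold ha hz w).1 hw).1⟩, ?_⟩
  · rw [powForm_reebField ha, hz.2, mul_zero]
  · exact nondegenerate_of_symplectic_pair hS.reeb_mem hS.form_reeb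
      (fun _ hw => hS.dForm_reeb_left hw) hS.nondegenerate (radialForm_V₁ ha hz.2)
      (radialForm_V₂ ha hz.2) (by rwa [dForm_V₁_V₂]) (mem_brieskornTangent_iff z)

/-! ### Global contact structures and comparison of the brackets. -/

theorem isContact_of_isContactPoint {a : Fin (n + 1) → ℕ} {M : Set (Fin (n + 1) → ℂ)} {m : ℕ}
    (hM : IsSubmanifold M (2 * m + 1))
    {T : (Fin (n + 1) → ℂ) → Submodule ℝ (Fin (n + 1) → ℂ)}
    (h : ∀ z ∈ M, IsContactPoint M (form a) z (T z) (reebField a z)) :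
    IsContact M (form a) m where
  contDiff := contDiff_form a
  submanifold := hM
  transverse z hz := ⟨reebField a z, (h z hz).isReebAt.1, by rw [(h z hz).form_reeb]; simp⟩
  nondegenerate z hz v hv hv0 hvw := (h z hz).nondegenerate v (((h z hz).mem_tangent v).1 hv) hv0
    fun w hw => hvw w (((h z hz).mem_tangent w).2 hw)

theorem jacobiBracket_manifold {a : Fin (n + 1) → ℕ} (ha : ∀ j, 0 < a j)
    {f g : (Fin (n + 1) → ℂ) → ℝ} (hf : IsSmoothOn (unitSphere n) f)
    (hg : IsSmoothOn (unitSphere n) g) {z : Fin (n + 1) → ℂ} (hz : z ∈ manifold a)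
    (hZf : differential (unitSphere n) f z (reebField a z) = 0)
    (hZg : differential (unitSphere n) g z (reebField a z) = 0) :
    jacobiBracket (manifold a) (form a) f g z =
      jacobiBracket (unitSphere n) (form a) f g z +
        (differential (unitSphere n) f z (V₂ a z) * differential (unitSphere n) g z (V₁ a z) -
          differential (unitSphere n) f z (V₁ a z) * differential (unitSphere n) g z (V₂ a z)) /
          mu a z := by
  have hsub := manifold_subset a
  have hS := isContactPoint_unitSphere ha (hsub hz)
  have hB := isContactPoint_manifold ha hz
  have hmu := mu_ne_zero ha (ne_zero_of_mem_unitSphere (hsub hz))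
  have hV₁ : V₁ a z ∈ sphereTangent z := radialForm_V₁ ha hz.2
  have hV₂ : V₂ a z ∈ sphereTangent z := radialForm_V₂ ha hz.2
  have hres : ∀ {f : (Fin (n + 1) → ℂ) → ℝ}, IsSmoothOn (unitSphere n) f →
      ∀ w ∈ brieskornTangent a z,
        differential (manifold a) f z w = differential (unitSphere n) f z w :=
    fun hf w hw => differential_eq_of_subset hsub hf hz ((hB.mem_tangent w).2 hw)
  have hZfB := (hres hf _ hB.reeb_mem).trans hZf
  have hZgB := (hres hg _ hB.reeb_mem).trans hZg
  obtain ⟨-, -, hF⟩ := hS.horizontalHam_spec hZf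
  obtain ⟨hGT, -, hG⟩ := hS.horizontalHam_spec hZg
  obtain ⟨hFBT, -, hFB⟩ := hB.horizontalHam_spec hZfB
  obtain ⟨-, -, hGB⟩ := hB.horizontalHam_spec hZgB
  -- Each differential is minus a pairing with `dα`, and the signs cancel in the products.
  rw [hB.jacobiBracket_eq hZfB hZgB, hS.jacobiBracket_eq hZf hZg,
    dForm_of_symplectic_pair (F := horizontalHam (unitSphere n) (form a) f z) hV₁ hV₂ (by rwa [dForm_V₁_V₂]) (mem_brieskornTangent_iff z) hGT hFBT
      (fun w hw => neg_injective (by rw [hFB w hw, hF w hw.1, hres hf w hw]))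
      (fun w hw => neg_injective (by rw [hGB w hw, hG w hw.1, hres hg w hw])),
    dForm_V₁_V₂, ← hF _ hV₁, ← hF _ hV₂, ← hG _ hV₁, ← hG _ hV₂]
  ring

end Brieskorn

end

open ContactGeometry Brieskorn in
theorem theorem4p1 (n : ℕ) (a : Fin (n + 1) → ℕ) (ha : ∀ j, 0 < a j) :
    ContactGeometry.IsContact (Brieskorn.unitSphere n) (Brieskorn.form a) n ∧
    ContactGeometry.IsContact (Brieskorn.manifold a) (Brieskorn.form a) (n - 1) ∧
    (∀ z ∈ Brieskorn.unitSphere n, ContactGeometry.IsReebAt (Brieskorn.unitSphere n)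
      (Brieskorn.form a) z (Brieskorn.reebField a z)) ∧
    (∀ z ∈ Brieskorn.manifold a, ContactGeometry.IsReebAt (Brieskorn.manifold a)
      (Brieskorn.form a) z (Brieskorn.reebField a z)) ∧
    (∀ z ∈ Brieskorn.manifold a,
      Brieskorn.V₁ a z ∈ ContactGeometry.tangentSpaceAt (Brieskorn.unitSphere n) z ∧
      Brieskorn.V₂ a z ∈ ContactGeometry.tangentSpaceAt (Brieskorn.unitSphere n) z ∧
      Brieskorn.mu a z = 2 * ∑ j, (a j : ℝ) * (‖z j‖ ^ 2) ^ (a j - 1) ∧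
      Brieskorn.mu a z ≠ 0) ∧
    ∀ f g : (Fin (n + 1) → ℂ) → ℝ,
      ContactGeometry.IsSmoothOn (Brieskorn.unitSphere n) f →
      ContactGeometry.IsSmoothOn (Brieskorn.unitSphere n) g →
      (∀ z ∈ Brieskorn.unitSphere n, ContactGeometry.differential (Brieskorn.unitSphere n) f z
        (Brieskorn.reebField a z) = 0) →
      (∀ z ∈ Brieskorn.unitSphere n, ContactGeometry.differential (Brieskorn.unitSphere n) g z
        (Brieskorn.reebField a z) = 0) →
      ∀ z ∈ Brieskorn.manifold a,
        ContactGeometry.jacobiBracket (Brieskorn.manifold a) (Brieskorn.form a) f g z =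
          ContactGeometry.jacobiBracket (Brieskorn.unitSphere n) (Brieskorn.form a) f g z +
          (ContactGeometry.differential (Brieskorn.unitSphere n) f z (Brieskorn.V₂ a z) *
              ContactGeometry.differential (Brieskorn.unitSphere n) g z (Brieskorn.V₁ a z) -
            ContactGeometry.differential (Brieskorn.unitSphere n) f z (Brieskorn.V₁ a z) *
              ContactGeometry.differential (Brieskorn.unitSphere n) g z (Brieskorn.V₂ a z)) /
            Brieskorn.mu a z := by
  refine ⟨isContact_of_isContactPoint isSubmanifold_unitSphere fun _ => isContactPoint_unitSphere ha,
    isContact_of_isContactPoint (isSubmanifold_manifold ha) fun _ => isContactPoint_manifold ha,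
    fun _ hz => (isContactPoint_unitSphere ha hz).isReebAt,
    fun _ hz => (isContactPoint_manifold ha hz).isReebAt,
    fun z hz => ⟨?_, ?_, ?_, mu_ne_zero ha (ne_zero_of_mem_unitSphere (manifold_subset a hz))⟩,
    fun f g hf hg hZf hZg z hz => jacobiBracket_manifold ha hf hg hz
      (hZf z (manifold_subset a hz)) (hZg z (manifold_subset a hz))⟩
  · exact (mem_tangentSpaceAt_unitSphere (manifold_subset a hz) _).2 (radialForm_V₁ ha hz.2)
  · exact (mem_tangentSpaceAt_unitSphere (manifold_subset a hz) _).2 (radialForm_V₂ ha hz.2)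
  · simp only [mu, pow_mul]
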